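/- Fix a set $\mathit{Var}$ of variables, a set $A$ of actions, and a signature $\Sigma$, that is, a set of function symbols with finite arities. **Terms.** The terms $\mathbb{T}(\Sigma)$ are built from variables, operator applications $f(t_1,\dots,t_n)$, and recursion terms $\langle X|S\rangle$. Here $S=\{Y=S_Y\mid Y\in V_S\}$ with $V_S\subseteq\mathit{Var}$ is a recursive specification, with arbitrary terms $S_Y$ (the set $V_S$ may be infinite), $X\in V_S$, and the variables in $V_S$ are bound in $\langle X|S\rangle$. Write $\mathbb{T}(\Sigma,W)$ for the terms with free variables in $W$, and $\mathsf{T}(\Sigma)=\mathbb{T}(\Sigma,\emptyset)$ for the closed terms. Substitution $t[\sigma]$ avoids capture, and $\langle t|S\rangle:=t[\langle Y|S\rangle/Y]_{Y\in V_S}$. **TSSs.** A transition system specification (TSS) $P$ is a set of rules $\frac{H}{t\xrightarrow{a}u}$, where $H$ is a set of positive literals $t'\xrightarrow{b}u'$ and negative literals $t'\stackrel{b}{\nrightarrow}$. It is positive if no rule has a negative premise. A proof of $\frac{H}{\alpha}$ from $P$ is a well-founded, possibly infinitely branching, tree of literals with root $\alpha$ in which each node either is a leaf in $H$ or forms, together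 with its children, a substitution instance of a rule of $P$. **Format.** A positive TSS is in the tyft/tyxt format with recursion if * for every recursive specification $S$, every $X\in V_S$ and every $a\in A$ it contains a rule $\frac{\langle S_X|S\rangle\xrightarrow{a}z}{\langle X|S\rangle\xrightarrow{a}z}$ with $z$ a variable not free in $\langle X|S\rangle$; and * in each of its other rules, the source is either a variable or of the form $f(x_1,\dots,x_n)$ with distinct variables $x_i$, and the right-hand sides of the premises are pairwise distinct variables not occurring in the source. **Bisimilarity.** Let $\langle CT,PT\rangle$ be the well-founded semantics of $P$. Thus, for ordinals $\lambda$, $PT_\lambda$ is the set of closed transitions provable from the closed negative literals $p\stackrel{a}{\nrightarrow}$ not denied by any transition $p\xrightarrow{a}q$ in $\bigcup_{\kappa<\lambda}CT_\kappa$; $CT_\lambda$ is the set of closed transitions provable from the closed negative literals not denied by any transition in $PT_\lambda$; and $CT=\bigcup_\lambda CT_\lambda$, $PT=\bigcap_\lambda PT_\lambda$. (For positive $P$, both $CT$ and $PT$ are simply the set of provable closed transitions.) A bisimulation is a relation $R$ on $\mathsf{T}(\Sigma)$ such that, whenever $p\,R\,q$ and $a\in A$: each $p\xrightarrow{a}p'$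 in $CT$ is matched by some $q\xrightarrow{a}q'$ in $CT$ with $p'\,R\,q'$, and each $q\xrightarrow{a}q'$ in $PT$ is matched by some $p\xrightarrow{a}p'$ in $PT$ with $p'\,R\,q'$. Write $p\sqsubseteq_B q$ (bisimilarity) if some bisimulation relates $p$ to $q$, and ${\equiv_B}:={\sqsubseteq_B}\cap{\sqsupseteq_B}$. **Theorem.** Let $P$ be a positive TSS in the tyft/tyxt format with recursion. Then bisimilarity is a full congruence. That is, $\sqsubseteq_B$ is reflexive, transitive and symmetric (so it coincides with $\equiv_B$), and, writing $\sim$ for it: 1. for every $n$-ary function symbol $f$ of $\Sigma$ and all closed $p_i,q_i$: if $p_i\sim q_i$ for $i=1,\dots,n$, then $f(p_1,\dots,p_n)\sim f(q_1,\dots,q_n)$; 2. for all $W\subseteq\mathit{Var}$ and all recursive specifications $S,S':W\to\mathbb{T}(\Sigma,W)$: if $S_Y[\sigma]\sim S'_Y[\sigma]$ for all $Y\in W$ and all $\sigma:W\to\mathsf{T}(\Sigma)$, then $\langle X|S\rangle\sim\langle X|S'\rangle$ for all $X\in W$. -/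

import Mathlib

universe u v w

namespace SOS

/-- A signature: a collection of function declarations, each with a finite arity. -/
structure Signature where
  Decl : Type v
  arity : Decl → ℕ

/-- `Term Sg Var W` is the set of terms with recursion over the signature `Sg` whose free
variables are drawn from `W`; names of bound variables are taken from `Var`.  So
`Term Sg Var Var` is the set of all (open) terms and `Term Sg Var PEmpty` the set of closed
terms.

In `fix V S X`, that is `⟨X|S⟩`, the set `V ⊆ Var` is the set of variables bound by the recursive
specification `S`.  An occurrence of a variable in the right-hand side `S Y` is tagged with `inr`
if this specification binds it and with `inl` if it refers to the surrounding scope.  Because the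
scope of each occurrence is recorded, substitution never captures a variable and needs no
renaming of bound variables. -/
inductive Term (Sg : Signature.{v}) (Var : Type u) : Type u → Type (max (u + 1) v)
  | var {W : Type u} (x : W) : Term Sg Var W
  | op {W : Type u} (f : Sg.Decl) (ts : Fin (Sg.arity f) → Term Sg Var W) : Term Sg Var W
  | fix {W : Type u} (V : Set Var) (S : V → Term Sg Var (W ⊕ V)) (X : V) : Term Sg Var W

/-- The closed terms (processes). -/
abbrev ClosedTerm (Sg : Signature.{v}) (Var : Type u) : Type (max (u + 1) v) :=
  Term Sg Var PEmpty.{u + 1}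

namespace Term

/-- The set of variables that occur free in a term. -/
def fv {Sg : Signature.{v}} {Var : Type u} : {W : Type u} → Term Sg Var W → Set W
  | _, var x => {x}
  | _, op _ ts => {x | ∃ i, x ∈ fv (ts i)}
  | _, fix _ S _ => {x | ∃ Y, Sum.inl x ∈ fv (S Y)}

/-- Replacement of free variables by variables. -/
def rename {Sg : Signature.{v}} {Var : Type u} :
    {W W' : Type u} → (W → W') → Term Sg Var W → Term Sg Var W'
  | _, _, g, var x => var (g x)
  | _, _, g, op f ts => op f (fun i => rename g (ts i))
  | _, _, g, fix V S X => fix V (fun Y => rename (Sum.map g id) (S Y)) X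

/-- A substitution extended to the scope of a recursive specification: the bound variables are
left alone. -/
def lift {Sg : Signature.{v}} {Var : Type u} {W W' : Type u} (V : Set Var)
    (σ : W → Term Sg Var W') : W ⊕ V → Term Sg Var (W' ⊕ V) :=
  Sum.elim (fun x => rename Sum.inl (σ x)) (fun Y => var (Sum.inr Y))

/-- The substitution instance `t[σ]`. -/
def subst {Sg : Signature.{v}} {Var : Type u} :
    {W W' : Type u} → (W → Term Sg Var W') → Term Sg Var W → Term Sg Var W'
  | _, _, σ, var x => σ x
  | _, _, σ, op f ts => op f (fun i => subst σ (ts i))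
  | _, _, σ, fix V S X => fix V (fun Y => subst (lift V σ) (S Y)) X

open Classical in
/-- The open term `⟨X|S⟩` for a recursive specification `S : V → 𝕋(Σ)` given by open terms: in the
right-hand sides exactly the free occurrences of the variables in `V` become bound. -/
noncomputable def mu {Sg : Signature.{v}} {Var : Type u} (V : Set Var)
    (S : V → Term Sg Var Var) (X : V) : Term Sg Var Var :=
  fix V (fun Y => rename (fun x => if h : x ∈ V then Sum.inr ⟨x, h⟩ else Sum.inl x) (S Y)) X

open Classical in
/-- `⟨t|S⟩`, that is `t[⟨Y|S⟩ / Y]` with `Y` ranging over the bound variables of `S`. -/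
noncomputable def muTerm {Sg : Signature.{v}} {Var : Type u} (V : Set Var)
    (S : V → Term Sg Var Var) (t : Term Sg Var Var) : Term Sg Var Var :=
  subst (fun y => if h : y ∈ V then mu V S ⟨y, h⟩ else var y) t

/-- The closed term `⟨X|S⟩` for a recursive specification `S : W → 𝕋(Σ, W)`, all of whose
variables are bound. -/
def closedMu {Sg : Signature.{v}} {Var : Type u} (W : Set Var) (S : W → Term Sg Var W) (X : W) :
    ClosedTerm Sg Var :=
  fix W (fun Y => rename Sum.inr (S Y)) X

/-- A closed term regarded as an open term. -/
def toOpen {Sg : Signature.{v}} {Var : Type u} (p : ClosedTerm Sg Var) : Term Sg Var Var :=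
  rename PEmpty.elim p

end Term

/-- Literals `t -a→ t'` and `t -a↛`. -/
inductive Literal (Sg : Signature.{v}) (Var : Type u) (A : Type w) : Type (max (u + 1) v w)
  | pos (t : Term Sg Var Var) (a : A) (t' : Term Sg Var Var) : Literal Sg Var A
  | neg (t : Term Sg Var Var) (a : A) : Literal Sg Var A

/-- Substitution instances of literals. -/
def Literal.subst {Sg : Signature.{v}} {Var : Type u} {A : Type w}
    (σ : Var → Term Sg Var Var) : Literal Sg Var A → Literal Sg Var A
  | .pos t a t' => .pos (t.subst σ) a (t'.subst σ)
  | .neg t a => .neg (t.subst σ) a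

/-- A transition rule: a set of premises and the conclusion `source -label→ target`. -/
structure Rule (Sg : Signature.{v}) (Var : Type u) (A : Type w) where
  premises : Set (Literal Sg Var A)
  source : Term Sg Var Var
  label : A
  target : Term Sg Var Var

/-- The conclusion of a rule. -/
def Rule.conclusion {Sg : Signature.{v}} {Var : Type u} {A : Type w} (r : Rule Sg Var A) :
    Literal Sg Var A :=
  .pos r.source r.label r.target

/-- A transition system specification over `Sg`, given by its set of rules. -/
structure TSS (Sg : Signature.{v}) (Var : Type u) (A : Type w) where
  rules : Set (Rule Sg Var A)

/-- A two-valued transition relation on processes. -/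
abbrev TransRel (Sg : Signature.{v}) (Var : Type u) (A : Type w) : Type (max (u + 1) v w) :=
  ClosedTerm Sg Var → A → ClosedTerm Sg Var → Prop

/-- `Provable P H β`: there is a proof of `H / β` from `P`, i.e. a well-founded (possibly
infinitely branching) tree of literals in which each node is a hypothesis without children, or
forms together with its children a substitution instance of a rule. -/
inductive Provable {Sg : Signature.{v}} {Var : Type u} {A : Type w} (P : TSS Sg Var A)
    (H : Set (Literal Sg Var A)) : Literal Sg Var A → Prop
  | hyp (β : Literal Sg Var A) (hβ : β ∈ H) : Provable P H β
  | rule (r : Rule Sg Var A) (hr : r ∈ P.rules) (σ : Var → Term Sg Var Var)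
      (hprem : ∀ β ∈ r.premises, Provable P H (β.subst σ)) :
      Provable P H (r.conclusion.subst σ)

/-- The closed negative literals that do not deny any transition in `T`. -/
def undenied {Sg : Signature.{v}} {Var : Type u} {A : Type w} (T : TransRel Sg Var A) :
    Set (Literal Sg Var A) :=
  {β | ∃ (p : ClosedTerm Sg Var) (a : A), β = .neg p.toOpen a ∧ ∀ q, ¬ T p a q}

namespace TSS

/-- The closed transitions that are provable from the hypotheses `N`. -/
def derived {Sg : Signature.{v}} {Var : Type u} {A : Type w} (P : TSS Sg Var A)
    (N : Set (Literal Sg Var A)) : TransRel Sg Var A :=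
  fun p a q => Provable P N (.pos p.toOpen a q.toOpen)

/-- The under-approximation `CT⁺_l`.  Reading the nested term from the inside, one finds
`PT⁻_l`, `PT⁺_l`, `CT⁻_l` and `CT⁺_l`. -/
def ctAt {Sg : Signature.{v}} {Var : Type u} {A : Type w} (P : TSS Sg Var A)
    (l : Ordinal.{max (u + 1) v w}) : TransRel Sg Var A :=
  P.derived (undenied (P.derived (undenied (fun p a q => ∃ k, ∃ _ : k < l, ctAt P k p a q))))
termination_by l

/-- The over-approximation `PT⁺_l`. -/
def ptAt {Sg : Signature.{v}} {Var : Type u} {A : Type w} (P : TSS Sg Var A)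
    (l : Ordinal.{max (u + 1) v w}) : TransRel Sg Var A :=
  P.derived (undenied (fun p a q => ∃ k < l, P.ctAt k p a q))

/-- The certain transitions of the well-founded semantics.  As `ctAt` increases and `ptAt`
decreases with the ordinal, the union and the intersection below are the values at the closure
ordinal. -/
def Certain {Sg : Signature.{v}} {Var : Type u} {A : Type w} (P : TSS Sg Var A) :
    TransRel Sg Var A :=
  fun p a q => ∃ l, P.ctAt l p a q

/-- The possible transitions of the well-founded semantics. -/
def Possible {Sg : Signature.{v}} {Var : Type u} {A : Type w} (P : TSS Sg Var A) :
    TransRel Sg Var A :=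
  fun p a q => ∀ l, P.ptAt l p a q

/-- Bisimulations on the three-valued transition system of `P`. -/
def IsBisimulation {Sg : Signature.{v}} {Var : Type u} {A : Type w} (P : TSS Sg Var A)
    (R : ClosedTerm Sg Var → ClosedTerm Sg Var → Prop) : Prop :=
  ∀ p q, R p q → ∀ a,
    (∀ p', P.Certain p a p' → ∃ q', P.Certain q a q' ∧ R p' q') ∧
    (∀ q', P.Possible q a q' → ∃ p', P.Possible p a p' ∧ R p' q')

/-- The bisimulation preorder `p ⊑_B q`, also called bisimilarity. -/
def BisimLE {Sg : Signature.{v}} {Var : Type u} {A : Type w} (P : TSS Sg Var A)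
    (p q : ClosedTerm Sg Var) : Prop :=
  ∃ R : ClosedTerm Sg Var → ClosedTerm Sg Var → Prop, P.IsBisimulation R ∧ R p q

/-- Bisimulation equivalence `p ≡_B q`: the kernel of the bisimulation preorder. -/
def BisimEquiv {Sg : Signature.{v}} {Var : Type u} {A : Type w} (P : TSS Sg Var A)
    (p q : ClosedTerm Sg Var) : Prop :=
  P.BisimLE p q ∧ P.BisimLE q p

end TSS

namespace Rule

/-- The right-hand sides of the positive premises are variables that are all distinct and that do
not occur in the source. -/
def IsNtytt {Sg : Signature.{v}} {Var : Type u} {A : Type w} (r : Rule Sg Var A) : Prop :=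
  (∀ t a t', Literal.pos t a t' ∈ r.premises → ∃ y, t' = .var y ∧ y ∉ r.source.fv) ∧
  (∀ t₁ a₁ t₂ a₂ t', Literal.pos t₁ a₁ t' ∈ r.premises → Literal.pos t₂ a₂ t' ∈ r.premises →
    t₁ = t₂ ∧ a₁ = a₂)

/-- An ntytt rule whose source is a variable. -/
def IsNtyxt {Sg : Signature.{v}} {Var : Type u} {A : Type w} (r : Rule Sg Var A) : Prop :=
  r.IsNtytt ∧ ∃ x, r.source = .var x

/-- An ntytt rule with source `f(x₁,…,xₙ)`, the `xᵢ` being distinct variables. -/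
def IsNtyft {Sg : Signature.{v}} {Var : Type u} {A : Type w} (r : Rule Sg Var A) : Prop :=
  r.IsNtytt ∧ ∃ (f : Sg.Decl) (x : Fin (Sg.arity f) → Var),
    Function.Injective x ∧ r.source = .op f (fun i => .var (x i))

/-- The recursion rule with premise `⟨S_X|S⟩ -a→ z` and conclusion `⟨X|S⟩ -a→ z`. -/
noncomputable def recursion {Sg : Signature.{v}} {Var : Type u} {A : Type w} (V : Set Var)
    (S : V → Term Sg Var Var) (X : V) (a : A) (z : Var) : Rule Sg Var A where
  premises := {.pos (Term.muTerm V S (S X)) a (.var z)}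
  source := Term.mu V S X
  label := a
  target := .var z

end Rule

namespace TSS

/-- A TSS is positive if it has no negative premises. -/
def IsPositive {Sg : Signature.{v}} {Var : Type u} {A : Type w} (P : TSS Sg Var A) : Prop :=
  ∀ r ∈ P.rules, ∀ t a, Literal.neg t a ∉ r.premises

/-- The ntyft/ntyxt format with recursion: for all `S`, `X` and `a` there is a recursion rule, whose
variable `z` is fresh, and all other rules are ntyft or ntyxt rules. -/
def IsNtyftNtyxtWithRecursion {Sg : Signature.{v}} {Var : Type u} {A : Type w}
    (P : TSS Sg Var A) : Prop :=
  (∀ (V : Set Var) (S : V → Term Sg Var Var) (X : V) (a : A),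
    ∃ z, z ∉ (Term.mu V S X).fv ∧ Rule.recursion V S X a z ∈ P.rules) ∧
  (∀ r ∈ P.rules,
    (∃ (V : Set Var) (S : V → Term Sg Var Var) (X : V) (a : A) (z : Var),
      z ∉ (Term.mu V S X).fv ∧ r = Rule.recursion V S X a z) ∨ r.IsNtyft ∨ r.IsNtyxt)

/-- The tyft/tyxt format with recursion: no negative premises. -/
def IsTyftTyxtWithRecursion {Sg : Signature.{v}} {Var : Type u} {A : Type w}
    (P : TSS Sg Var A) : Prop :=
  P.IsPositive ∧ P.IsNtyftNtyxtWithRecursion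

end TSS

/-- Full precongruences: preorders on processes that are preserved by all operators and by
replacing the right-hand sides of recursive specifications `S : W → 𝕋(Σ, W)` by right-hand sides
that are related under all closed substitutions. -/
structure IsFullPrecongruence {Sg : Signature.{v}} {Var : Type u}
    (R : ClosedTerm Sg Var → ClosedTerm Sg Var → Prop) : Prop where
  refl : ∀ p, R p p
  trans : ∀ p q r, R p q → R q r → R p r
  op : ∀ (f : Sg.Decl) (p q : Fin (Sg.arity f) → ClosedTerm Sg Var),
    (∀ i, R (p i) (q i)) → R (.op f p) (.op f q)
  recursion : ∀ (W : Set Var) (S S' : W → Term Sg Var W),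
    (∀ (Y : W) (σ : W → ClosedTerm Sg Var), R ((S Y).subst σ) ((S' Y).subst σ)) →
    ∀ X : W, R (Term.closedMu W S X) (Term.closedMu W S' X)

/-- Full congruences: symmetric full precongruences. -/
structure IsFullCongruence {Sg : Signature.{v}} {Var : Type u}
    (R : ClosedTerm Sg Var → ClosedTerm Sg Var → Prop) : Prop extends IsFullPrecongruence R where
  symm : ∀ p q, R p q → R q p

end SOS

/-!
For a positive specification both `CT` and `PT` consist of the closed transitions that have a proof
in which all literals are closed, so bisimilarity is symmetric. Congruence amounts to lifting the
transitions of `C[p]` to `C[q]` for terms `p` related to terms `q`. By induction on proofs a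
transition is lifted for all ways of marking related subterms in its source at once, with a marking
of its target that depends monotonically on the marking of the source. As the premises of a `tyft`
rule may depend on each other cyclically, its variables cannot be treated one after another.
However, the markings of a term form a chain complete partial order, so all premises are solved
simultaneously by a least fixed point, which again depends monotonically on the marking of the
source.

Recursion is treated by a variant of Howe's method: the closure of the pairs `(⟨X|S⟩, ⟨X|S'⟩)` under
contexts and under composition with bisimilarity on the right is a simulation. It need not be
symmetric, but its composition with bisimilarity on the left is, and so is a bisimulation.
-/

universe z y

namespace SOS

section FixedPoints

variable {α : Type*} {β : Type*} {γ : Type*}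

/-- Chain completeness: every chain, also the empty one, has a least upper bound. -/
def IsChainComplete (β : Type*) [Preorder β] : Prop :=
  ∀ c : Set β, IsChain (· ≤ ·) c → ∃ x, IsLUB c x

theorem IsChainComplete.of_unique [Preorder β] [Unique β] : IsChainComplete β :=
  fun _ _ => ⟨default, fun x _ => (Unique.eq_default x).le, fun x _ => (Unique.default_eq x).le⟩

theorem IsChainComplete.of_orderIso [Preorder β] [Preorder γ] (h : IsChainComplete β)
    (e : β ≃o γ) : IsChainComplete γ := by
  intro c hc
  obtain ⟨x, hx⟩ := h (e.symm '' c) (hc.image e.symm)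
  exact ⟨e x, e.symm.isLUB_image.1 hx⟩

theorem IsChainComplete.pi {β : α → Type*} [∀ i, Preorder (β i)]
    (h : ∀ i, IsChainComplete (β i)) : IsChainComplete (∀ i, β i) := by
  intro c hc
  choose x hx using fun i =>
    h i (Function.eval i '' c) (hc.image_of_map_rel _ _ _ fun _ _ hxy => hxy i)
  exact ⟨x, isLUB_pi.2 hx⟩

theorem IsChainComplete.exists_least_fixedPoint [PartialOrder β] (h : IsChainComplete β)
    (f : β →o β) : ∃ x, f x = x ∧ ∀ y, f y ≤ y → x ≤ y := by
  obtain ⟨x, ⟨hx, hleast⟩, hmax⟩ := zorn_le₀ {x | x ≤ f x ∧ ∀ y, f y ≤ y → x ≤ y} (by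
    intro c hcs hc
    obtain ⟨x, hx⟩ := h c hc
    exact ⟨x, ⟨hx.2 fun y hy => (hcs hy).1.trans (f.monotone (hx.1 hy)),
      fun z hz => hx.2 fun y hy => (hcs hy).2 z hz⟩, fun y hy => hx.1 hy⟩)
  have hfx : f x ≤ x :=
    hmax ⟨f.monotone hx, fun y hy => (f.monotone (hleast y hy)).trans hy⟩ hx
  exact ⟨x, hfx.antisymm hx, hleast⟩

theorem IsChainComplete.exists_monotone_fixedPoint [Preorder α] [PartialOrder β]
    (h : IsChainComplete β) (f : α × β →o β) : ∃ g : α →o β, ∀ a, f (a, g a) = g a := by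
  choose g hg hleast using fun a =>
    h.exists_least_fixedPoint ⟨fun x => f (a, x), fun _ _ hxy => f.monotone ⟨le_rfl, hxy⟩⟩
  refine ⟨⟨g, fun a b hab => hleast a _ ?_⟩, hg⟩
  exact (f.monotone (show (a, g b) ≤ (b, g b) from ⟨hab, le_rfl⟩)).trans_eq (hg b)

theorem exists_monotone_extension {X : Type*} {β : X → Type*} [∀ i, Preorder (β i)]
    [∀ i, OrderBot (β i)] {x : α → X} (hx : Function.Injective x) :
    ∃ E : (∀ i, β (x i)) →o ∀ j, β j, ∀ τ i, E τ (x i) = τ i := by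
  have extend_at (j : X) : ∃ e : (∀ i, β (x i)) →o β j, ∀ τ i (h : x i = j), e τ = h ▸ τ i := by
    by_cases hj : ∃ i, x i = j
    · obtain ⟨i, rfl⟩ := hj
      refine ⟨Pi.evalOrderHom i, fun τ i' h => ?_⟩
      obtain rfl := hx h
      rfl
    · exact ⟨⟨fun _ => ⊥, fun _ _ _ => le_rfl⟩, fun _ i h => absurd ⟨i, h⟩ hj⟩
  choose e he using extend_at
  exact ⟨OrderHom.pi e, fun τ i => he _ τ i rfl⟩

end FixedPoints

namespace Term

variable {Sg : Signature.{v}} {Var : Type u} {W W' W'' : Type u}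

theorem rename_rename (t : Term Sg Var W) : ∀ {W' W'' : Type u} (g : W → W') (h : W' → W''),
    rename h (rename g t) = rename (h ∘ g) t := by
  induction t with
  | var x => intros; rfl
  | op f ts ih => intros; simp only [rename, ih]
  | fix V S X ih => intros; simp only [rename, ih, Sum.map_comp_map, Function.id_comp]

theorem lift_comp_map (V : Set Var) (g : W → W') (σ : W' → Term Sg Var W'') :
    lift V σ ∘ Sum.map g id = lift V (σ ∘ g) := by
  funext x; cases x <;> rfl

theorem subst_rename (t : Term Sg Var W) : ∀ {W' W'' : Type u} (g : W → W')
    (σ : W' → Term Sg Var W''), subst σ (rename g t) = subst (σ ∘ g) t := by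
  induction t with
  | var x => intros; rfl
  | op f ts ih => intros; simp only [rename, subst, ih]
  | fix V S X ih => intros; simp only [rename, subst, ih, lift_comp_map]

theorem rename_comp_lift (V : Set Var) (σ : W → Term Sg Var W') (g : W' → W'') :
    rename (Sum.map g id) ∘ lift V σ = lift V (rename g ∘ σ) := by
  funext x
  cases x with
  | inl x => simp only [Function.comp_apply, lift, Sum.elim_inl, rename_rename]; rfl
  | inr x => rfl

theorem rename_subst (t : Term Sg Var W) : ∀ {W' W'' : Type u} (σ : W → Term Sg Var W')
    (g : W' → W''), rename g (subst σ t) = subst (rename g ∘ σ) t := by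
  induction t with
  | var x => intros; rfl
  | op f ts ih => intros; simp only [rename, subst, ih]
  | fix V S X ih => intros; simp only [rename, subst, ih, rename_comp_lift]

theorem subst_comp_lift (V : Set Var) (σ : W → Term Sg Var W') (τ : W' → Term Sg Var W'') :
    subst (lift V τ) ∘ lift V σ = lift V (subst τ ∘ σ) := by
  funext x
  cases x with
  | inl x => simp only [Function.comp_apply, lift, Sum.elim_inl, subst_rename, rename_subst]; rfl
  | inr x => rfl

theorem subst_subst (t : Term Sg Var W) : ∀ {W' W'' : Type u} (σ : W → Term Sg Var W')
    (τ : W' → Term Sg Var W''), subst τ (subst σ t) = subst (subst τ ∘ σ) t := by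
  induction t with
  | var x => intros; rfl
  | op f ts ih => intros; simp only [subst, ih]
  | fix V S X ih => intros; simp only [subst, ih, subst_comp_lift]

theorem lift_var (V : Set Var) : lift V (var : W → Term Sg Var W) = var := by
  funext x; cases x <;> rfl

theorem subst_var (t : Term Sg Var W) : subst var t = t := by
  induction t with
  | var x => rfl
  | op f ts ih => simp only [subst, ih]
  | fix V S X ih => simp only [subst, lift_var, ih]

theorem rename_eq_subst (g : W → W') (t : Term Sg Var W) : rename g t = subst (var ∘ g) t := by
  rw [← subst_var (rename g t), subst_rename]

theorem subst_congr_fv (t : Term Sg Var W) : ∀ {W' : Type u} {σ τ : W → Term Sg Var W'},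
    (∀ x ∈ t.fv, σ x = τ x) → t.subst σ = t.subst τ := by
  induction t with
  | var x => intro W' σ τ h; exact h x rfl
  | op f ts ih =>
    intro W' σ τ h
    simp only [subst]
    congr 1
    funext i
    exact ih i fun x hx => h x ⟨i, hx⟩
  | fix V S X ih =>
    intro W' σ τ h
    simp only [subst]
    congr 1
    funext Y
    refine ih Y fun x hx => ?_
    cases x with
    | inl x => simp only [lift, Sum.elim_inl, h x ⟨Y, hx⟩]
    | inr x => rfl

theorem subst_closed (σ : PEmpty → ClosedTerm Sg Var) (p : ClosedTerm Sg Var) :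
    subst σ p = p := by
  rw [show σ = var from funext fun x => x.elim, subst_var]

theorem toOpen_subst (t : Term Sg Var Var) (σ : Var → ClosedTerm Sg Var) :
    (t.subst σ).toOpen = t.subst fun x => (σ x).toOpen :=
  rename_subst t σ PEmpty.elim

theorem subst_toOpen (p : ClosedTerm Sg Var) (σ : Var → ClosedTerm Sg Var) :
    p.toOpen.subst σ = p := by
  rw [toOpen, subst_rename, subst_closed]

/-- A closed term regarded as a term in the scope `W`. -/
def weaken (p : ClosedTerm Sg Var) : Term Sg Var W :=
  rename PEmpty.elim p

theorem subst_weaken (σ : W → Term Sg Var W') (p : ClosedTerm Sg Var) :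
    subst σ (weaken p) = weaken p := by
  rw [weaken, subst_rename, weaken, rename_eq_subst]; congr 1; funext x; exact x.elim

theorem rename_weaken (g : W → W') (p : ClosedTerm Sg Var) :
    rename g (weaken p) = weaken p := by
  rw [rename_eq_subst, subst_weaken]

theorem weaken_closed (p : ClosedTerm Sg Var) : (weaken p : ClosedTerm Sg Var) = p := by
  rw [weaken, rename_eq_subst, subst_closed]

/-- The unfolding `⟨S_X|S⟩` of the closed term `⟨X|S⟩`. -/
def unfold (V : Set Var) (S : V → Term Sg Var (PEmpty ⊕ V)) (X : V) : ClosedTerm Sg Var :=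
  subst (Sum.elim PEmpty.elim (fix V S)) (S X)

theorem unfold_rename_inr (V : Set Var) (S : V → Term Sg Var V) (X : V) :
    unfold V (fun Y => rename Sum.inr (S Y)) X = (S X).subst (closedMu V S) := by
  rw [unfold, subst_rename]; rfl

theorem exists_fix_eq_mu_subst (V : Set Var) (S : V → Term Sg Var Var) (X : V)
    (σ : Var → ClosedTerm Sg Var) : ∃ S' : V → Term Sg Var (PEmpty ⊕ V),
      (mu V S X).subst σ = fix V S' X ∧ (muTerm V S (S X)).subst σ = unfold V S' X := by
  classical
  refine ⟨_, rfl, ?_⟩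
  rw [muTerm, unfold, subst_subst, subst_rename, subst_subst]
  congr 1
  funext y
  simp only [Function.comp_apply]
  split_ifs with h
  · rfl
  · simp only [subst, lift, Sum.elim_inl]
    rw [subst_rename, subst_closed]

theorem exists_mu_subst_eq_fix (V : Set Var) (S : V → Term Sg Var (PEmpty ⊕ V)) (X : V) :
    ∃ S' : V → Term Sg Var Var, ∀ σ : Var → ClosedTerm Sg Var,
      (mu V S' X).subst σ = fix V S X ∧ (muTerm V S' (S' X)).subst σ = unfold V S X := by
  classical
  let S' : V → Term Sg Var Var := fun Y => rename (Sum.elim PEmpty.elim Subtype.val) (S Y)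
  have mu_subst_eq (Y : V) (σ : Var → ClosedTerm Sg Var) : (mu V S' Y).subst σ = fix V S Y := by
    simp only [S', mu, subst, subst_rename]
    congr 1
    funext Z
    conv_rhs => rw [← subst_var (S Z)]
    congr 1
    funext y
    rcases y with y | y
    · exact y.elim
    · simp [lift]
  refine ⟨S', fun σ => ⟨mu_subst_eq X σ, ?_⟩⟩
  rw [muTerm, unfold, subst_subst, subst_rename]
  congr 1
  funext y
  rcases y with y | y
  · exact y.elim
  · simp [mu_subst_eq]

end Term

/-- The signature `Sg` with an extra constant for each `a : α`, the marker of `a`. -/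
def Signature.withMarkers (Sg : Signature.{v}) (α : Type z) : Signature.{max v z} where
  Decl := Sg.Decl ⊕ α
  arity := Sum.elim Sg.arity fun _ => 0

/-- Terms in which markers from `α` may occur. They are the contexts with holes indexed by `α`. -/
abbrev MarkedTerm (Sg : Signature.{v}) (Var : Type u) (α : Type z) (W : Type u) :
    Type (max (u + 1) v z) :=
  Term (Sg.withMarkers α) Var W

namespace MarkedTerm

open Term

variable {Sg : Signature.{v}} {Var : Type u} {α : Type z} {β : Type y} {W W' : Type u}

/-- The marker of `a` as a term. -/
def marker (a : α) : MarkedTerm Sg Var α W :=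
  .op (.inr a) fun i => i.elim0

theorem op_inr (a : α) (ts : Fin ((Sg.withMarkers α).arity (.inr a)) → MarkedTerm Sg Var α W) :
    .op (.inr a) ts = marker a := by
  rw [marker]; congr 1; funext i; exact i.elim0

/-- The term `t`, without markers, as a marked term. -/
def ofTerm : {W : Type u} → Term Sg Var W → MarkedTerm Sg Var α W
  | _, .var x => .var x
  | _, .op f ts => .op (.inl f) fun i => ofTerm (ts i)
  | _, .fix V S X => .fix V (fun Y => ofTerm (S Y)) X

/-- The term that results if the markers `a` stand for the closed terms `l a`. -/
def value (l : α → ClosedTerm Sg Var) : {W : Type u} → MarkedTerm Sg Var α W → Term Sg Var W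
  | _, .var x => .var x
  | _, .op (.inl f) ts => .op f fun i => value l (ts i)
  | _, .op (.inr a) _ => weaken (l a)
  | _, .fix V S X => .fix V (fun Y => value l (S Y)) X

/-- Change of markers. -/
def map (φ : α → β) : {W : Type u} → MarkedTerm Sg Var α W → MarkedTerm Sg Var β W
  | _, .var x => .var x
  | _, .op (.inl f) ts => .op (.inl f) fun i => map φ (ts i)
  | _, .op (.inr a) _ => marker (φ a)
  | _, .fix V S X => .fix V (fun Y => map φ (S Y)) X

variable (l : α → ClosedTerm Sg Var)

theorem rename_marker (g : W → W') (a : α) :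
    (marker a : MarkedTerm Sg Var α W).rename g = marker a :=
  op_inr a _

theorem subst_marker (σ : W → MarkedTerm Sg Var α W') (a : α) :
    (marker a : MarkedTerm Sg Var α W).subst σ = marker a :=
  op_inr a _

theorem value_marker (a : α) : value l (marker a) = l a :=
  weaken_closed (l a)

theorem value_map (φ : α → β) (l : β → ClosedTerm Sg Var) (m : MarkedTerm Sg Var α W) :
    value l (map φ m) = value (l ∘ φ) m := by
  induction m with
  | var x => rfl
  | op f ts ih =>
    rcases f with f | a
    · exact congrArg (Term.op f) (funext ih)
    · rfl
  | fix V S X ih => simp only [map, value, ih]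

theorem exists_eq_marker_of_map {φ : α → β} {m : MarkedTerm Sg Var α W} {b : β}
    (h : map φ m = marker b) : ∃ a, m = marker a := by
  rcases m with x | ⟨f | a, ts⟩ | _
  · cases h
  · cases h
  · exact ⟨a, op_inr a ts⟩
  · cases h

theorem value_ofTerm (t : Term Sg Var W) : value l (ofTerm t) = t := by
  induction t with
  | var x => rfl
  | op f ts ih => simp only [ofTerm, value, ih]
  | fix V S X ih => simp only [ofTerm, value, ih]

theorem ofTerm_rename (t : Term Sg Var W) : ∀ {W' : Type u} (g : W → W'),
    ofTerm (t.rename g) = (ofTerm t : MarkedTerm Sg Var α W).rename g := by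
  induction t with
  | var x => intros; rfl
  | op f ts ih => intro _ g; exact congrArg (Term.op _) (funext fun i => ih i g)
  | fix V S X ih => intros; simp only [rename, ofTerm, ih]

theorem value_rename (m : MarkedTerm Sg Var α W) : ∀ {W' : Type u} (g : W → W'),
    value l (m.rename g) = (value l m).rename g := by
  induction m with
  | var x => intros; rfl
  | op f ts ih =>
    intro _ g
    rcases f with f | a
    · exact congrArg (Term.op f) (funext fun i => ih i g)
    · exact (rename_weaken g (l a)).symm
  | fix V S X ih => intros; simp only [rename, value, ih]

theorem value_comp_lift (V : Set Var) (σ : W → MarkedTerm Sg Var α W') :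
    value l ∘ lift V σ = lift V (value l ∘ σ) := by
  funext x
  cases x with
  | inl x => exact value_rename l (σ x) Sum.inl
  | inr x => rfl

theorem value_subst (m : MarkedTerm Sg Var α W) : ∀ {W' : Type u}
    (σ : W → MarkedTerm Sg Var α W'), value l (m.subst σ) = (value l m).subst (value l ∘ σ) := by
  induction m with
  | var x => intros; rfl
  | op f ts ih =>
    intro _ σ
    rcases f with f | a
    · exact congrArg (Term.op f) (funext fun i => ih i σ)
    · exact (subst_weaken (value l ∘ σ) (l a)).symm
  | fix V S X ih => intros; simp only [subst, value, ih, value_comp_lift]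

theorem value_unfold (V : Set Var) (S : V → MarkedTerm Sg Var α (PEmpty ⊕ V)) (X : V) :
    value l (unfold V S X) = unfold V (fun Y => value l (S Y)) X := by
  rw [unfold, value_subst, unfold]
  congr 1
  funext x
  rcases x with x | Y
  · exact x.elim
  · rfl

theorem ofTerm_weaken (p : ClosedTerm Sg Var) :
    ofTerm (weaken p) = (weaken (ofTerm p) : MarkedTerm Sg Var α W) :=
  ofTerm_rename p _

theorem ofTerm_ne_marker (t : Term Sg Var W) (a : α) : ofTerm t ≠ marker a := by
  cases t <;> exact fun h => by cases h

/-- `Le l m n`: the marked term `m` arises from `n` by replacing some of the markers `a` by the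
terms `l a` for which they stand. -/
inductive Le (l : α → ClosedTerm Sg Var) :
    {W : Type u} → MarkedTerm Sg Var α W → MarkedTerm Sg Var α W → Prop
  | var {W : Type u} (x : W) : Le l (.var x) (.var x)
  | op {W : Type u} (f : (Sg.withMarkers α).Decl)
      (ms ns : Fin ((Sg.withMarkers α).arity f) → MarkedTerm Sg Var α W)
      (h : ∀ i, Le l (ms i) (ns i)) : Le l (.op f ms) (.op f ns)
  | fix {W : Type u} (V : Set Var) (S T : V → MarkedTerm Sg Var α (W ⊕ V)) (X : V)
      (h : ∀ Y, Le l (S Y) (T Y)) : Le l (.fix V S X) (.fix V T X)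
  | unmark {W : Type u} (a : α) : Le l (weaken (ofTerm (l a)) : MarkedTerm Sg Var α W) (marker a)

namespace Le

variable {l}

theorem refl (m : MarkedTerm Sg Var α W) : Le l m m := by
  induction m with
  | var x => exact .var x
  | op f ts ih => exact .op f ts ts ih
  | fix V S X ih => exact .fix V S S X ih

theorem of_var {m : MarkedTerm Sg Var α W} {x : W} (h : Le l m (.var x)) : m = .var x := by
  cases h; rfl

theorem of_op {m : MarkedTerm Sg Var α W} {f : Sg.Decl}
    {ns : Fin (Sg.arity f) → MarkedTerm Sg Var α W} (h : Le l m (.op (.inl f) ns)) :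
    ∃ ms, m = .op (.inl f) ms ∧ ∀ i, Le l (ms i) (ns i) := by
  cases h with
  | op f ms ns h => exact ⟨ms, rfl, h⟩

theorem of_fix {m : MarkedTerm Sg Var α W} {V : Set Var}
    {T : V → MarkedTerm Sg Var α (W ⊕ V)} {X : V} (h : Le l m (.fix V T X)) :
    ∃ S, m = .fix V S X ∧ ∀ Y, Le l (S Y) (T Y) := by
  cases h with
  | fix V S T X h => exact ⟨S, rfl, h⟩

theorem of_marker {m : MarkedTerm Sg Var α W} {a : α} (h : Le l m (marker a)) :
    m = marker a ∨ m = weaken (ofTerm (l a)) := by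
  generalize hn : (marker a : MarkedTerm Sg Var α W) = n at h
  cases h with
  | op f ms ns h =>
    cases hn
    exact .inl (op_inr a ms)
  | unmark b =>
    cases hn
    exact .inr rfl
  | _ => cases hn

theorem eq_of_le_ofTerm {t : Term Sg Var W} : ∀ {m : MarkedTerm Sg Var α W},
    Le l m (ofTerm t) → m = ofTerm t := by
  induction t with
  | var x => exact fun h => h.of_var
  | op f ts ih =>
    intro m h
    obtain ⟨ms, rfl, hms⟩ := h.of_op
    exact congrArg (Term.op _) (funext fun i => ih i (hms i))
  | fix V S X ih =>
    intro m h
    obtain ⟨T, rfl, hT⟩ := h.of_fix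
    exact congrArg (Term.fix V · X) (funext fun Y => ih Y (hT Y))

theorem eq_marker {n : MarkedTerm Sg Var α W} {a : α} (h : Le l (marker a) n) :
    n = marker a := by
  generalize hm : (marker a : MarkedTerm Sg Var α W) = m at h
  cases h with
  | op f ms ns h =>
    cases hm
    exact op_inr a ns
  | unmark b =>
    rw [← ofTerm_weaken] at hm
    exact absurd hm.symm (ofTerm_ne_marker _ a)
  | _ => cases hm

theorem ofTerm_value (m : MarkedTerm Sg Var α W) : Le l (ofTerm (value l m)) m := by
  induction m with
  | var x => exact .var x
  | op f ts ih =>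
    rcases f with f | a
    · exact .op (.inl f) _ _ ih
    · rw [op_inr]
      exact (ofTerm_weaken (l a)).symm ▸ .unmark a
  | fix V S X ih => exact .fix V _ _ X ih

theorem trans {k : MarkedTerm Sg Var α W} : ∀ {m n : MarkedTerm Sg Var α W},
    Le l m n → Le l n k → Le l m k := by
  induction k with
  | var x =>
    rintro m n hmn hnk
    rwa [hnk.of_var] at hmn
  | op f ks ih =>
    intro m n hmn hnk
    rcases f with f | a
    · obtain ⟨ns, rfl, hns⟩ := hnk.of_op
      obtain ⟨ms, rfl, hms⟩ := hmn.of_op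
      exact .op _ ms ks fun i => ih i (hms i) (hns i)
    · rw [op_inr] at hnk ⊢
      rcases hnk.of_marker with rfl | rfl
      · exact hmn
      · rw [← ofTerm_weaken] at hmn
        rw [eq_of_le_ofTerm hmn, ofTerm_weaken]
        exact .unmark a
  | fix V K X ih =>
    intro m n hmn hnk
    obtain ⟨N, rfl, hN⟩ := hnk.of_fix
    obtain ⟨M, rfl, hM⟩ := hmn.of_fix
    exact .fix V M K X fun Y => ih Y (hM Y) (hN Y)

theorem antisymm {m n : MarkedTerm Sg Var α W} (hmn : Le l m n) : Le l n m → m = n := by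
  induction hmn with
  | var x => exact fun _ => rfl
  | op f ms ns h ih =>
    intro hnm
    rcases f with f | a
    · obtain ⟨ns', hns', hle⟩ := hnm.of_op
      cases hns'
      exact congrArg (Term.op _) (funext fun i => ih i (hle i))
    · rw [op_inr, op_inr]
  | fix V S T X _ ih =>
    intro hnm
    obtain ⟨T', hT', hle⟩ := hnm.of_fix
    cases hT'
    exact congrArg (Term.fix V · X) (funext fun Y => ih Y (hle Y))
  | unmark a => exact fun hnm => hnm.eq_marker

theorem rename {m n : MarkedTerm Sg Var α W} (h : Le l m n) : ∀ {W' : Type u} (g : W → W'),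
    Le l (m.rename g) (n.rename g) := by
  induction h with
  | var x => exact fun g => .var (g x)
  | op f ms ns _ ih => exact fun g => .op f _ _ fun i => ih i g
  | fix V S T X _ ih => exact fun g => .fix V _ _ X fun Y => ih Y (Sum.map g id)
  | unmark a =>
    intro W' g
    rw [rename_weaken, rename_marker]
    exact .unmark a

theorem lift {σ τ : W → MarkedTerm Sg Var α W'} (h : ∀ x, Le l (σ x) (τ x)) (V : Set Var) :
    ∀ x, Le l (Term.lift V σ x) (Term.lift V τ x)
  | .inl x => (h x).rename Sum.inl
  | .inr Y => .var (Sum.inr Y)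

theorem subst {m n : MarkedTerm Sg Var α W} (h : Le l m n) :
    ∀ {W' : Type u} {σ τ : W → MarkedTerm Sg Var α W'},
      (∀ x, Le l (σ x) (τ x)) → Le l (m.subst σ) (n.subst τ) := by
  induction h with
  | var x => exact fun hστ => hστ x
  | op f ms ns _ ih => exact fun hστ => .op f _ _ fun i => ih i hστ
  | fix V S T X _ ih => exact fun hστ => .fix V _ _ X fun Y => ih Y (lift hστ V)
  | unmark a =>
    intro W' σ τ _
    rw [subst_weaken, subst_marker]
    exact .unmark a

end Le

end MarkedTerm

/-- The markings of `s`: the ways to obtain `s` as the value of a marked term. -/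
structure Marking {Sg : Signature.{v}} {Var : Type u} {α : Type z} (l : α → ClosedTerm Sg Var)
    {W : Type u} (s : Term Sg Var W) where
  val : MarkedTerm Sg Var α W
  value_eq : MarkedTerm.value l val = s

namespace Marking

open Term MarkedTerm

variable {Sg : Signature.{v}} {Var : Type u} {α : Type z} {l : α → ClosedTerm Sg Var}
  {W W' : Type u} {s : Term Sg Var W}

theorem val_injective : Function.Injective (val : Marking l s → MarkedTerm Sg Var α W) := by
  rintro ⟨m, _⟩ ⟨n, _⟩ rfl
  rfl

instance : PartialOrder (Marking l s) where
  le m n := Le l m.val n.val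
  le_refl m := .refl m.val
  le_trans _ _ _ hmn hnk := hmn.trans hnk
  le_antisymm _ _ hmn hnm := val_injective (hmn.antisymm hnm)

instance : OrderBot (Marking l s) where
  bot := ⟨ofTerm s, value_ofTerm l s⟩
  bot_le m := by
    obtain ⟨m, rfl⟩ := m
    exact .ofTerm_value m

theorem value_bot (r : α → ClosedTerm Sg Var) : value r (⊥ : Marking l s).val = s :=
  value_ofTerm r s

/-- A marking is proper if it is not just a marker. -/
def IsProper (m : Marking l s) : Prop :=
  ∀ a, m.val ≠ marker a

theorem isProper_bot : (⊥ : Marking l s).IsProper :=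
  ofTerm_ne_marker s

theorem isProper_or_eq_of_le {m n : Marking l s} (h : m ≤ n) :
    (m.IsProper ∧ n.IsProper) ∨ m = ⊥ ∨ m = n := by
  by_cases hn : n.IsProper
  · by_cases hm : m.IsProper
    · exact .inl ⟨hm, hn⟩
    · simp only [IsProper, not_forall, not_not] at hm
      obtain ⟨a, ha⟩ := hm
      exact absurd (Le.eq_marker (ha ▸ h : Le l (marker a) n.val)) (hn a)
  · simp only [IsProper, not_forall, not_not] at hn
    obtain ⟨a, ha⟩ := hn
    rcases Le.of_marker (ha ▸ h : Le l m.val (marker a)) with hm | hm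
    · exact .inr (.inr (val_injective (hm.trans ha.symm)))
    · refine .inr (.inl (val_injective ?_))
      have hs : s = weaken (l a) := by rw [← n.value_eq, ha]; rfl
      rw [hm, ← ofTerm_weaken, ← hs]
      rfl

theorem isChainComplete_of_isProper
    (h : IsChainComplete {m : Marking l s // m.IsProper}) : IsChainComplete (Marking l s) := by
  intro c hc
  by_cases hproper : ∀ m ∈ c, m.IsProper
  · by_cases hbot : ∀ m ∈ c, m = ⊥
    · exact ⟨⊥, fun m hm => (hbot m hm).le, fun _ _ => bot_le⟩
    · push Not at hbot
      obtain ⟨m, hm, hm_bot⟩ := hbot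
      obtain ⟨x, hx⟩ := h (Subtype.val ⁻¹' c) (hc.preimage _ _ _ Subtype.val_injective
        fun _ _ hxy => hxy)
      refine ⟨x.1, fun n hn => hx.1 (show ⟨n, hproper n hn⟩ ∈ Subtype.val ⁻¹' c from hn),
        fun n hn => ?_⟩
      have hn_proper : n.IsProper := by
        rcases isProper_or_eq_of_le (hn hm) with ⟨-, h⟩ | h | h
        · exact h
        · exact absurd h hm_bot
        · exact h ▸ hproper m hm
      exact hx.2 (show ⟨n, hn_proper⟩ ∈ upperBounds _ from fun k hk => hn hk)
  · push Not at hproper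
    obtain ⟨m, hm, hm_marker⟩ := hproper
    have le_of_mem (n : Marking l s) (hn : n ∈ c) : n ≤ m := by
      refine (hc.total hn hm).elim id fun hmn => ?_
      rcases isProper_or_eq_of_le hmn with ⟨h, -⟩ | h | h
      · exact absurd h hm_marker
      · exact absurd (h ▸ isProper_bot) hm_marker
      · exact h.ge
    exact ⟨m, le_of_mem, fun n hn => hn hm⟩

theorem exists_orderHom_of_isProper {β : Type*} [Preorder β] [OrderBot β]
    {Q : Marking l s → β → Prop} (hbot : Q ⊥ ⊥) (F : {m : Marking l s // m.IsProper} →o β)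
    (hF : ∀ m, Q m.1 (F m)) (hmarker : ∀ m : Marking l s, ¬m.IsProper → ∃ b, Q m b) :
    ∃ G : Marking l s →o β, ∀ m, Q m (G m) := by
  classical
  choose g hg using hmarker
  -- Sending `⊥` to `⊥` makes the values at markers irrelevant for monotonicity.
  refine ⟨⟨fun m => if m = ⊥ then ⊥ else if hm : m.IsProper then F ⟨m, hm⟩ else g m hm,
    fun m n hmn => ?_⟩, fun m => ?_⟩
  · rcases isProper_or_eq_of_le hmn with ⟨hm, hn⟩ | rfl | rfl
    · by_cases hm_bot : m = ⊥
      · simp only [hm_bot, if_true, bot_le]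
      · have hn_bot : n ≠ ⊥ := fun h => hm_bot (le_bot_iff.1 (h ▸ hmn))
        simpa only [hm_bot, hn_bot, if_false, hm, hn, dif_pos] using F.monotone hmn
    · simp only [if_true, bot_le]
    · exact le_rfl
  · change Q m (if m = ⊥ then ⊥ else if hm : m.IsProper then F ⟨m, hm⟩ else g m hm)
    split_ifs with hm_bot hm
    · exact hm_bot ▸ hbot
    · exact hF ⟨m, hm⟩
    · exact hg m hm

theorem eq_bot_of_var {x : W} (m : Marking l (.var x : Term Sg Var W)) (hm : m.IsProper) :
    m = ⊥ := by
  obtain ⟨m, hmx⟩ := m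
  rcases m with y | ⟨f | a, ts⟩ | _
  · cases hmx
    rfl
  · cases hmx
  · exact absurd (op_inr a ts) (hm a)
  · cases hmx

/-- The proper markings of an operator application are given by markings of the arguments. -/
noncomputable def opIso (f : Sg.Decl) (ts : Fin (Sg.arity f) → Term Sg Var W) :
    (∀ i, Marking l (ts i)) ≃o {m : Marking l (.op f ts) // m.IsProper} :=
  RelIso.ofSurjective
    (OrderEmbedding.ofMapLEIff
      (fun τ => ⟨⟨.op (.inl f) fun i => (τ i).val,
        congrArg (Term.op f) (funext fun i => (τ i).value_eq)⟩, fun a h => by cases h⟩)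
      fun τ τ' => ⟨fun h i => by obtain ⟨ms, hms, h⟩ := Le.of_op h; cases hms; exact h i,
        fun h => Le.op (.inl f) _ _ h⟩)
    (by
      rintro ⟨⟨m, hmf⟩, hm⟩
      rcases m with _ | ⟨g | a, ms⟩ | _
      · cases hmf
      · cases hmf
        exact ⟨fun i => ⟨ms i, rfl⟩, rfl⟩
      · exact absurd (op_inr a ms) (hm a)
      · cases hmf)

/-- The proper markings of a recursion term are given by markings of the right-hand sides. -/
noncomputable def fixIso (V : Set Var) (S : V → Term Sg Var (W ⊕ V)) (X : V) :
    (∀ Y, Marking l (S Y)) ≃o {m : Marking l (.fix V S X) // m.IsProper} :=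
  RelIso.ofSurjective
    (OrderEmbedding.ofMapLEIff
      (fun τ => ⟨⟨.fix V (fun Y => (τ Y).val) X,
        congrArg (Term.fix V · X) (funext fun Y => (τ Y).value_eq)⟩, fun a h => by cases h⟩)
      fun τ τ' => ⟨fun h Y => by obtain ⟨T, hT, h⟩ := Le.of_fix h; cases hT; exact h Y,
        fun h => Le.fix V _ _ X h⟩)
    (by
      rintro ⟨⟨m, hmf⟩, hm⟩
      rcases m with _ | ⟨g | a, ms⟩ | ⟨_, T, _⟩
      · cases hmf
      · cases hmf
      · exact absurd (op_inr a ms) (hm a)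
      · cases hmf
        exact ⟨fun Y => ⟨T Y, rfl⟩, rfl⟩)

theorem isChainComplete (s : Term Sg Var W) : IsChainComplete (Marking l s) := by
  induction s with
  | var x =>
    apply isChainComplete_of_isProper
    have : Unique {m : Marking l (.var x) // m.IsProper} :=
      ⟨⟨⟨⊥, isProper_bot⟩⟩, fun m => Subtype.ext (eq_bot_of_var m.1 m.2)⟩
    exact .of_unique
  | op f ts ih =>
    exact isChainComplete_of_isProper ((IsChainComplete.pi ih).of_orderIso (opIso f ts))
  | fix V S X ih =>
    exact isChainComplete_of_isProper ((IsChainComplete.pi ih).of_orderIso (fixIso V S X))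

/-- The marking of `t[σ]` that consists of markings of the terms `σ x`. -/
def subst (t : Term Sg Var W) {σ : W → Term Sg Var W'} :
    (∀ x, Marking l (σ x)) →o Marking l (t.subst σ) where
  toFun τ := ⟨(ofTerm t).subst fun x => (τ x).val, by
    rw [value_subst, value_ofTerm]
    exact congrArg (t.subst ·) (funext fun x => (τ x).value_eq)⟩
  monotone' _ _ h := (Le.refl (ofTerm t)).subst h

theorem value_subst (r : α → ClosedTerm Sg Var) (t : Term Sg Var W) {σ : W → Term Sg Var W'}
    (τ : ∀ x, Marking l (σ x)) :
    value r (Marking.subst t τ).val = t.subst fun x => value r (τ x).val := by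
  rw [Marking.subst]
  exact (MarkedTerm.value_subst r _ _).trans (by rw [value_ofTerm]; rfl)

/-- The marking of the unfolding of `⟨X|S⟩` given by markings of the right-hand sides. -/
def unfold (V : Set Var) (S : V → Term Sg Var (PEmpty ⊕ V)) (X : V) :
    (∀ Y, Marking l (S Y)) →o Marking l (Term.unfold V S X) where
  toFun τ := ⟨Term.unfold V (fun Y => (τ Y).val) X, by
    rw [value_unfold]
    exact congrArg (Term.unfold V · X) (funext fun Y => (τ Y).value_eq)⟩
  monotone' _ _ h := (h X).subst fun
    | .inl x => x.elim
    | .inr Y => Le.fix V _ _ Y h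

end Marking

section ContextClosure

open Term MarkedTerm

variable {Sg : Signature.{v}} {Var : Type u} {R : ClosedTerm Sg Var → ClosedTerm Sg Var → Prop}

/-- A pair of closed terms related by `R`. Such pairs serve as markers. -/
structure RelatedPair (R : ClosedTerm Sg Var → ClosedTerm Sg Var → Prop) where
  left : ClosedTerm Sg Var
  right : ClosedTerm Sg Var
  rel : R left right

/-- The context closure of `R`: it relates the values of a context with holes filled by terms that
are related by `R`. -/
def ContextClosure (R : ClosedTerm Sg Var → ClosedTerm Sg Var → Prop)
    (p q : ClosedTerm Sg Var) : Prop :=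
  ∃ m : MarkedTerm Sg Var (RelatedPair R) PEmpty,
    value RelatedPair.left m = p ∧ value RelatedPair.right m = q

theorem contextClosure_value {α : Type z} {l r : α → ClosedTerm Sg Var} (h : ∀ a, R (l a) (r a))
    (m : MarkedTerm Sg Var α PEmpty) : ContextClosure R (value l m) (value r m) :=
  ⟨map (fun a => ⟨l a, r a, h a⟩) m, value_map _ _ m, value_map _ _ m⟩

theorem ContextClosure.of_rel {p q : ClosedTerm Sg Var} (h : R p q) : ContextClosure R p q :=
  ⟨marker ⟨p, q, h⟩, value_marker _ _, value_marker _ _⟩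

theorem ContextClosure.symm (hsymm : ∀ {p q}, R p q → R q p) {p q : ClosedTerm Sg Var} :
    ContextClosure R p q → ContextClosure R q p := by
  rintro ⟨m, rfl, rfl⟩
  exact contextClosure_value (fun x => hsymm x.rel) m

theorem Marking.contextClosure {p : ClosedTerm Sg Var}
    (m : Marking (RelatedPair.left (R := R)) p) :
    ContextClosure R p (value RelatedPair.right m.val) :=
  ⟨m.val, m.value_eq, rfl⟩

/-- The marking of `p` as the left component of a related pair. -/
def Marking.ofRel {p q : ClosedTerm Sg Var} (h : R p q) :
    Marking (RelatedPair.left (R := R)) p :=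
  ⟨marker ⟨p, q, h⟩, value_marker _ _⟩

theorem Marking.value_ofRel {p q : ClosedTerm Sg Var} (h : R p q) :
    value RelatedPair.right (Marking.ofRel h).val = q :=
  value_marker _ _

end ContextClosure

namespace TSS

open Term MarkedTerm

variable {Sg : Signature.{v}} {Var : Type u} {A : Type w} {P : TSS Sg Var A}

section Steps

/-- The closed transitions that have a proof from `P` without hypotheses in which all literals are
closed and positive. For positive `P` these are all transitions of the well-founded semantics. -/
inductive Step (P : TSS Sg Var A) : TransRel Sg Var A
  | rule (r : Rule Sg Var A) (hr : r ∈ P.rules) (σ : Var → ClosedTerm Sg Var)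
      (hprem : ∀ t a t', Literal.pos t a t' ∈ r.premises →
        Step P (t.subst σ) a (t'.subst σ)) :
      Step P (r.source.subst σ) r.label (r.target.subst σ)

theorem Step.provable (hP : P.IsPositive) (N : Set (Literal Sg Var A)) {p q : ClosedTerm Sg Var}
    {a : A} (h : P.Step p a q) : Provable P N (.pos p.toOpen a q.toOpen) := by
  induction h with
  | rule r hr σ _ ih =>
    have hprov := Provable.rule (P := P) (H := N) r hr (fun x => (σ x).toOpen) (by
      rintro (⟨t, a, t'⟩ | ⟨t, a⟩) hβ
      · simpa only [Literal.subst, toOpen_subst] using ih t a t' hβ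
      · exact absurd hβ (hP r hr t a))
    simpa only [Literal.subst, Rule.conclusion, toOpen_subst] using hprov

theorem step_of_provable {N : Set (Literal Sg Var A)} (hN : ∀ β ∈ N, ∃ t a, β = .neg t a)
    {β : Literal Sg Var A} (h : Provable P N β) (σ : Var → ClosedTerm Sg Var) :
    ∀ t a t', β = .pos t a t' → P.Step (t.subst σ) a (t'.subst σ) := by
  induction h with
  | hyp β hβ =>
    rintro t a t' rfl
    obtain ⟨_, _, h⟩ := hN _ hβ
    cases h
  | rule r hr τ _ ih =>
    intro t a t' h
    cases h
    rw [subst_subst, subst_subst]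
    refine Step.rule r hr _ fun t a t' hβ => ?_
    have hstep := ih _ hβ _ _ _ rfl
    rwa [subst_subst, subst_subst] at hstep

theorem derived_undenied_iff (hP : P.IsPositive) (T : TransRel Sg Var A)
    {p q : ClosedTerm Sg Var} {a : A} : P.derived (undenied T) p a q ↔ P.Step p a q := by
  refine ⟨fun h => ?_, fun h => h.provable hP _⟩
  have hN : ∀ β ∈ undenied T, ∃ t a, β = .neg t a := fun β ⟨p, a, h, _⟩ => ⟨p.toOpen, a, h⟩
  simpa only [subst_toOpen] using step_of_provable hN h (fun _ => p) _ _ _ rfl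

theorem certain_iff (hP : P.IsPositive) {p q : ClosedTerm Sg Var} {a : A} :
    P.Certain p a q ↔ P.Step p a q := by
  have ctAt_iff (l) : P.ctAt l p a q ↔ P.Step p a q := by
    rw [ctAt]
    exact derived_undenied_iff hP _
  simp only [Certain, ctAt_iff, exists_const]

theorem possible_iff (hP : P.IsPositive) {p q : ClosedTerm Sg Var} {a : A} :
    P.Possible p a q ↔ P.Step p a q := by
  simp only [Possible, ptAt, derived_undenied_iff hP, forall_const]

theorem Step.fix (hP : P.IsNtyftNtyxtWithRecursion) {V : Set Var}
    {S : V → Term Sg Var (PEmpty ⊕ V)} {X : V} {a : A} {p : ClosedTerm Sg Var}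
    (h : P.Step (unfold V S X) a p) : P.Step (.fix V S X) a p := by
  obtain ⟨S', hS'⟩ := exists_mu_subst_eq_fix V S X
  obtain ⟨hmu, hunfold⟩ := hS' fun _ => p
  obtain ⟨z, -, hz⟩ := hP.1 V S' X a
  have hstep := Step.rule _ hz (fun _ => p) (by
    rintro t b t' h'
    cases h'
    exact hunfold ▸ h)
  exact hmu ▸ hstep

end Steps

section Bisimilarity

/-- Simulations with respect to the closed transitions. -/
def IsSimulation (P : TSS Sg Var A) (R : ClosedTerm Sg Var → ClosedTerm Sg Var → Prop) : Prop :=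
  ∀ p q, R p q → ∀ a p', P.Step p a p' → ∃ q', P.Step q a q' ∧ R p' q'

theorem isBisimulation_iff (hP : P.IsPositive)
    {R : ClosedTerm Sg Var → ClosedTerm Sg Var → Prop} :
    P.IsBisimulation R ↔ P.IsSimulation R ∧ P.IsSimulation (flip R) := by
  simp only [IsBisimulation, certain_iff hP, possible_iff hP]
  exact ⟨fun h => ⟨fun p q hpq a => (h p q hpq a).1, fun q p hpq a => (h p q hpq a).2⟩,
    fun h p q hpq a => ⟨h.1 p q hpq a, h.2 q p hpq a⟩⟩

theorem bisimLE_of_isSimulation (hP : P.IsPositive)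
    {R : ClosedTerm Sg Var → ClosedTerm Sg Var → Prop} (hsim : P.IsSimulation R)
    (hsymm : ∀ {p q}, R p q → R q p) {p q : ClosedTerm Sg Var} (h : R p q) : P.BisimLE p q := by
  have hflip : flip R = R := funext₂ fun _ _ => propext ⟨hsymm, hsymm⟩
  exact ⟨R, (isBisimulation_iff hP).2 ⟨hsim, hflip.symm ▸ hsim⟩, h⟩

theorem BisimLE.refl (p : ClosedTerm Sg Var) : P.BisimLE p p :=
  ⟨Eq, by
    rintro p _ rfl a
    exact ⟨fun p' h => ⟨p', h, rfl⟩, fun p' h => ⟨p', h, rfl⟩⟩, rfl⟩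

theorem BisimLE.trans {p q r : ClosedTerm Sg Var} : P.BisimLE p q → P.BisimLE q r →
    P.BisimLE p r := by
  rintro ⟨R, hR, hpq⟩ ⟨R', hR', hqr⟩
  refine ⟨Relation.Comp R R', ?_, q, hpq, hqr⟩
  rintro p r ⟨q, hpq, hqr⟩ a
  constructor
  · intro p' hp
    obtain ⟨q', hq, hpq'⟩ := (hR p q hpq a).1 p' hp
    obtain ⟨r', hr, hqr'⟩ := (hR' q r hqr a).1 q' hq
    exact ⟨r', hr, q', hpq', hqr'⟩
  · intro r' hr
    obtain ⟨q', hq, hqr'⟩ := (hR' q r hqr a).2 r' hr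
    obtain ⟨p', hp, hpq'⟩ := (hR p q hpq a).2 q' hq
    exact ⟨p', hp, q', hpq', hqr'⟩

theorem BisimLE.symm (hP : P.IsPositive) {p q : ClosedTerm Sg Var} :
    P.BisimLE p q → P.BisimLE q p := by
  rintro ⟨R, hR, hpq⟩
  exact ⟨flip R, (isBisimulation_iff hP).2 ((isBisimulation_iff hP).1 hR).symm, hpq⟩

theorem isSimulation_bisimLE (hP : P.IsPositive) : P.IsSimulation P.BisimLE := by
  rintro p q ⟨R, hR, hpq⟩ a p' hp
  obtain ⟨q', hq, hpq'⟩ := ((isBisimulation_iff hP).1 hR).1 p q hpq a p' hp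
  exact ⟨q', hq, R, hR, hpq'⟩

end Bisimilarity

section Lifting

variable {α : Type z} {l r : α → ClosedTerm Sg Var}

/-- The transition `s -b→ s'` lifts to markings: it can be replayed when the markers `a` are
reinterpreted as `r a` instead of `l a`, with a target that depends monotonically on the marking
of `s`. -/
def Lifts (P : TSS Sg Var A) (l r : α → ClosedTerm Sg Var) (s : ClosedTerm Sg Var) (b : A)
    (s' : ClosedTerm Sg Var) : Prop :=
  ∃ F : Marking l s →o Marking l s', ∀ m, P.Step (value r m.val) b (value r (F m).val)

/-- The transition `s -b→ s'` lifts to the proper markings of `s`. -/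
def LiftsProper (P : TSS Sg Var A) (l r : α → ClosedTerm Sg Var) (s : ClosedTerm Sg Var) (b : A)
    (s' : ClosedTerm Sg Var) : Prop :=
  ∃ F : {m : Marking l s // m.IsProper} →o Marking l s',
    ∀ m, P.Step (value r m.1.val) b (value r (F m).val)

theorem LiftsProper.lifts {s s' : ClosedTerm Sg Var} {b : A} (h : P.LiftsProper l r s b s')
    (hstep : P.Step s b s')
    (hmarker : ∀ a, l a = s → ∃ m : Marking l s', P.Step (r a) b (value r m.val)) :
    P.Lifts l r s b s' := by
  obtain ⟨F, hF⟩ := h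
  refine Marking.exists_orderHom_of_isProper
    (Q := fun m m' => P.Step (value r m.val) b (value r m'.val)) ?_ F hF fun m hm => ?_
  · simpa only [Marking.value_bot] using hstep
  · simp only [Marking.IsProper, not_forall, not_not] at hm
    obtain ⟨a, ha⟩ := hm
    have hs : l a = s := by rw [← m.value_eq, ha, value_marker]
    simpa only [ha, value_marker] using hmarker a hs

theorem exists_next_marking {ρ : Rule Sg Var A} (hntytt : ρ.IsNtytt)
    {σ : Var → ClosedTerm Sg Var} (hprem : ∀ t a t', Literal.pos t a t' ∈ ρ.premises →
      P.Lifts l r (t.subst σ) a (t'.subst σ)) (y : Var) :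
    ∃ f : (∀ x, Marking l (σ x)) × (∀ x, Marking l (σ x)) →o Marking l (σ y),
      (y ∈ ρ.source.fv → ∀ τ, f τ = τ.1 y) ∧
      ∀ t a, Literal.pos t a (.var y) ∈ ρ.premises → ∀ τ,
        P.Step (value r (Marking.subst t τ.2).val) a (value r (f τ).val) := by
  by_cases hy : ∃ t a, Literal.pos t a (.var y) ∈ ρ.premises
  · obtain ⟨t, a, hta⟩ := hy
    obtain ⟨F, hF⟩ := hprem t a (.var y) hta
    refine ⟨(F.comp (Marking.subst t)).comp OrderHom.snd, fun hsource => ?_,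
      fun t' a' hta' τ => ?_⟩
    · obtain ⟨_, ⟨⟩, hfresh⟩ := hntytt.1 t a _ hta
      exact absurd hsource hfresh
    · obtain ⟨rfl, rfl⟩ := hntytt.2 t a t' a' _ hta hta'
      exact hF (Marking.subst t τ.2)
  · exact ⟨(Pi.evalOrderHom y).comp OrderHom.fst, fun _ _ => rfl,
      fun t a hta => absurd ⟨t, a, hta⟩ hy⟩

theorem exists_premise_solution {ρ : Rule Sg Var A} (hntytt : ρ.IsNtytt)
    {σ : Var → ClosedTerm Sg Var} (hprem : ∀ t a t', Literal.pos t a t' ∈ ρ.premises →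
      P.Lifts l r (t.subst σ) a (t'.subst σ)) :
    ∃ g : (∀ x, Marking l (σ x)) →o ∀ x, Marking l (σ x),
      (∀ τ, ∀ x ∈ ρ.source.fv, g τ x = τ x) ∧
      ∀ τ t a t', Literal.pos t a t' ∈ ρ.premises →
        P.Step (t.subst fun x => value r (g τ x).val) a
          (t'.subst fun x => value r (g τ x).val) := by
  choose f hsource hf using exists_next_marking hntytt hprem
  obtain ⟨g, hg⟩ := (IsChainComplete.pi fun x => Marking.isChainComplete (l := l) (σ x))
    |>.exists_monotone_fixedPoint (OrderHom.pi f)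
  have f_eq (τ x) : f x (τ, g τ) = g τ x := congrFun (hg τ) x
  refine ⟨g, fun τ x hx => (f_eq τ x).symm.trans (hsource x hx _), fun τ t a t' hta => ?_⟩
  obtain ⟨y, rfl, -⟩ := hntytt.1 t a t' hta
  have hstep := hf y t a hta (τ, g τ)
  rwa [f_eq, Marking.value_subst] at hstep

theorem exists_orderHom_of_isNtytt {ρ : Rule Sg Var A} (hρ : ρ ∈ P.rules) (hntytt : ρ.IsNtytt)
    {σ : Var → ClosedTerm Sg Var} (hprem : ∀ t a t', Literal.pos t a t' ∈ ρ.premises →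
      P.Lifts l r (t.subst σ) a (t'.subst σ)) :
    ∃ F : (∀ x, Marking l (σ x)) →o Marking l (ρ.target.subst σ), ∀ τ,
      P.Step (value r (Marking.subst ρ.source τ).val) ρ.label (value r (F τ).val) := by
  obtain ⟨g, hsource, hg⟩ := exists_premise_solution hntytt hprem
  refine ⟨(Marking.subst ρ.target).comp g, fun τ => ?_⟩
  have hstep := Step.rule ρ hρ (fun x => value r (g τ x).val) (fun t a t' h => hg τ t a t' h)
  rw [subst_congr_fv ρ.source fun x hx => congrArg (fun m => value r m.val) (hsource τ x hx)]
    at hstep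
  simpa only [OrderHom.comp_coe, Function.comp_apply, Marking.value_subst] using hstep

theorem lifts_of_isNtyxt {ρ : Rule Sg Var A} (hρ : ρ ∈ P.rules) (hntyxt : ρ.IsNtyxt)
    {σ : Var → ClosedTerm Sg Var} (hprem : ∀ t a t', Literal.pos t a t' ∈ ρ.premises →
      P.Lifts l r (t.subst σ) a (t'.subst σ)) :
    P.Lifts l r (ρ.source.subst σ) ρ.label (ρ.target.subst σ) := by
  obtain ⟨hntytt, x, hx⟩ := hntyxt
  obtain ⟨F, hF⟩ := exists_orderHom_of_isNtytt hρ hntytt hprem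
  obtain ⟨E, hE⟩ := exists_monotone_extension (β := fun y => Marking l (σ y))
    (Function.injective_of_subsingleton fun _ : Unit => x)
  rw [hx]
  refine ⟨⟨fun m => F (E fun _ => m), fun m n h => F.monotone (E.monotone fun _ => h)⟩,
    fun m => ?_⟩
  have hE_x : E (fun _ => m) x = m := hE (fun _ => m) ()
  have hstep := hF (E fun _ => m)
  rw [hx, Marking.value_subst, Term.subst, hE_x] at hstep
  exact hstep

theorem liftsProper_of_isNtyft {ρ : Rule Sg Var A} (hρ : ρ ∈ P.rules) (hntytt : ρ.IsNtytt)
    {f : Sg.Decl} {x : Fin (Sg.arity f) → Var} (hx : Function.Injective x)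
    (hsource : ρ.source = .op f fun i => .var (x i))
    {σ : Var → ClosedTerm Sg Var} (hprem : ∀ t a t', Literal.pos t a t' ∈ ρ.premises →
      P.Lifts l r (t.subst σ) a (t'.subst σ)) :
    P.LiftsProper l r (.op f fun i => σ (x i)) ρ.label (ρ.target.subst σ) := by
  obtain ⟨F, hF⟩ := exists_orderHom_of_isNtytt hρ hntytt hprem
  obtain ⟨E, hE⟩ := exists_monotone_extension (β := fun y => Marking l (σ y)) hx
  let e := Marking.opIso (l := l) f fun i => σ (x i)
  refine ⟨⟨fun m => F (E (e.symm m)), fun m n h => F.monotone (E.monotone (e.symm.monotone h))⟩,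
    fun m => ?_⟩
  obtain ⟨τ, rfl⟩ := e.surjective m
  have hstep := hF (E τ)
  simp only [hsource, Marking.value_subst, Term.subst, hE] at hstep
  change P.Step (.op f fun i => value r (τ i).val) ρ.label (value r (F (E (e.symm (e τ)))).val)
  rwa [e.symm_apply_apply]

theorem liftsProper_fix (hP : P.IsNtyftNtyxtWithRecursion) {V : Set Var}
    {S : V → Term Sg Var (PEmpty ⊕ V)} {X : V} {b : A} {s' : ClosedTerm Sg Var}
    (h : P.Lifts l r (unfold V S X) b s') : P.LiftsProper l r (.fix V S X) b s' := by
  obtain ⟨F, hF⟩ := h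
  let e := Marking.fixIso (l := l) V S X
  refine ⟨⟨fun m => F (Marking.unfold V S X (e.symm m)),
    fun m n h => F.monotone ((Marking.unfold V S X).monotone (e.symm.monotone h))⟩, fun m => ?_⟩
  obtain ⟨τ, rfl⟩ := e.surjective m
  have hstep : P.Step (value r (Term.unfold V (fun Y => (τ Y).val) X)) b
    (value r (F (Marking.unfold V S X τ)).val) :=
    hF (Marking.unfold V S X τ)
  rw [value_unfold] at hstep
  change P.Step (.fix V (fun Y => value r (τ Y).val) X) b
    (value r (F (Marking.unfold V S X (e.symm (e τ)))).val)
  rw [e.symm_apply_apply]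
  exact hstep.fix hP

/-- From `q` one can simulate the transitions of `p`, up to contexts, provided that they lift to
the proper markings of `p` and, if `p` is a recursion term, that the corresponding transitions of
its unfolding lift. For `R p q` these provisos are the facts that are available when one lifts a
transition of `p` by induction on its derivation. -/
def LiftSimulates (P : TSS Sg Var A) (R : ClosedTerm Sg Var → ClosedTerm Sg Var → Prop)
    (p q : ClosedTerm Sg Var) : Prop :=
  ∀ b p', P.Step p b p' → P.LiftsProper (RelatedPair.left (R := R)) RelatedPair.right p b p' →
    (∀ V S X, p = .fix V S X →
      P.Lifts (RelatedPair.left (R := R)) RelatedPair.right (unfold V S X) b p') →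
    ∃ q', P.Step q b q' ∧ ContextClosure R p' q'

variable {R : ClosedTerm Sg Var → ClosedTerm Sg Var → Prop}

theorem Step.lifts (hP : P.IsNtyftNtyxtWithRecursion) (hR : ∀ p q, R p q → P.LiftSimulates R p q)
    {s s' : ClosedTerm Sg Var} {b : A} (h : P.Step s b s') :
    P.Lifts (RelatedPair.left (R := R)) RelatedPair.right s b s' := by
  have exists_marking (a : RelatedPair R) {b : A} {s' : ClosedTerm Sg Var}
      (hstep : P.Step a.left b s')
      (hproper : P.LiftsProper (RelatedPair.left (R := R)) RelatedPair.right a.left b s')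
      (hfix : ∀ V S X, a.left = .fix V S X →
        P.Lifts (RelatedPair.left (R := R)) RelatedPair.right (unfold V S X) b s') :
      ∃ m : Marking (RelatedPair.left (R := R)) s',
        P.Step a.right b (value RelatedPair.right m.val) := by
    obtain ⟨_, hq, m, hm, rfl⟩ := hR _ _ a.rel b s' hstep hproper hfix
    exact ⟨⟨m, hm⟩, hq⟩
  induction h with
  | rule ρ hρ σ hprem ih =>
    have hstep := Step.rule ρ hρ σ hprem
    rcases hP.2 ρ hρ with ⟨V, S, X, b, z, -, rfl⟩ | ⟨hntytt, f, x, hx, hsource⟩ | hntyxt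
    · obtain ⟨S', hsource, hunfold⟩ := exists_fix_eq_mu_subst V S X σ
      have hlift : P.Lifts RelatedPair.left RelatedPair.right (unfold V S' X) b (σ z) :=
        hunfold ▸ ih _ _ _ rfl
      change P.Lifts _ _ ((mu V S X).subst σ) b (σ z)
      change P.Step ((mu V S X).subst σ) b (σ z) at hstep
      rw [hsource] at hstep ⊢
      have hproper := liftsProper_fix hP hlift
      refine hproper.lifts hstep fun a ha => exists_marking a (ha ▸ hstep) (ha ▸ hproper) ?_
      intro V₁ S₁ X₁ h₁
      cases ha.symm.trans h₁
      exact hlift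
    · have hproper := liftsProper_of_isNtyft hρ hntytt hx hsource ih
      rw [hsource] at hstep ⊢
      refine hproper.lifts hstep fun a ha => exists_marking a (ha ▸ hstep) (ha ▸ hproper) ?_
      intro V S X h
      cases ha.symm.trans h
    · exact lifts_of_isNtyxt hρ hntyxt ih

theorem isSimulation_contextClosure (hP : P.IsNtyftNtyxtWithRecursion)
    (hR : ∀ p q, R p q → P.LiftSimulates R p q) : P.IsSimulation (ContextClosure R) := by
  rintro _ _ ⟨m, rfl, rfl⟩ a p' hp
  obtain ⟨F, hF⟩ := hp.lifts hP hR
  exact ⟨_, hF ⟨m, rfl⟩, (F ⟨m, rfl⟩).contextClosure⟩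

end Lifting

section OperatorCongruence

theorem BisimLE.value (hP : P.IsTyftTyxtWithRecursion) {α : Type z} {l r : α → ClosedTerm Sg Var}
    (h : ∀ a, P.BisimLE (l a) (r a)) (m : MarkedTerm Sg Var α PEmpty) :
    P.BisimLE (value l m) (value r m) := by
  refine bisimLE_of_isSimulation hP.1 (isSimulation_contextClosure hP.2 ?_)
    (ContextClosure.symm (BisimLE.symm hP.1)) (contextClosure_value h m)
  intro p q hpq b p' hp _ _
  obtain ⟨q', hq, hbisim⟩ := isSimulation_bisimLE hP.1 p q hpq b p' hp
  exact ⟨q', hq, .of_rel hbisim⟩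

theorem BisimLE.op (hP : P.IsTyftTyxtWithRecursion) {f : Sg.Decl}
    {p q : Fin (Sg.arity f) → ClosedTerm Sg Var} (h : ∀ i, P.BisimLE (p i) (q i)) :
    P.BisimLE (.op f p) (.op f q) := by
  have hvalue := BisimLE.value hP h (.op (.inl f) fun i => marker i)
  simpa only [MarkedTerm.value, value_marker] using hvalue

end OperatorCongruence

section HoweClosure

/-- An adaptation of Howe's closure of bisimilarity: the least relation that contains the pairs
`(⟨X|S⟩, ⟨X|S'⟩)` for recursive specifications `S` and `S'` with bisimilar right-hand sides, is
closed under contexts, and absorbs bisimilarity on the right. -/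
inductive HoweClosure (P : TSS Sg Var A) : ClosedTerm Sg Var → ClosedTerm Sg Var → Prop
  | mu (W : Set Var) (S S' : W → Term Sg Var W)
      (h : ∀ (Y : W) (σ : W → ClosedTerm Sg Var),
        P.BisimLE ((S Y).subst σ) ((S' Y).subst σ)) (X : W) :
      HoweClosure P (closedMu W S X) (closedMu W S' X)
  | context {α : Type (max (u + 1) v)} (l r : α → ClosedTerm Sg Var)
      (h : ∀ a, HoweClosure P (l a) (r a)) (m : MarkedTerm Sg Var α PEmpty) :
      HoweClosure P (value l m) (value r m)
  | trans_bisimLE {p q r : ClosedTerm Sg Var} (h : HoweClosure P p q) (hqr : P.BisimLE q r) :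
      HoweClosure P p r

theorem HoweClosure.of_contextClosure {p q : ClosedTerm Sg Var} :
    ContextClosure P.HoweClosure p q → P.HoweClosure p q := by
  rintro ⟨m, rfl, rfl⟩
  exact .context _ _ RelatedPair.rel m

theorem HoweClosure.exists_symm (hP : P.IsTyftTyxtWithRecursion) {p q : ClosedTerm Sg Var}
    (h : P.HoweClosure p q) : ∃ u, P.BisimLE q u ∧ P.HoweClosure u p := by
  induction h with
  | mu W S S' h X => exact ⟨_, .refl _, .mu W S' S (fun Y σ => (h Y σ).symm hP.1) X⟩
  | context l r _ m ih =>
    choose u hru hul using ih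
    exact ⟨value u m, .value hP hru m, .context u l hul m⟩
  | trans_bisimLE _ hqr ih =>
    obtain ⟨u, hqu, hup⟩ := ih
    exact ⟨u, (hqr.symm hP.1).trans hqu, hup⟩

theorem liftSimulates_of_bisimLE (hP : P.IsPositive) {p q r : ClosedTerm Sg Var}
    (h : P.LiftSimulates P.HoweClosure p q) (hqr : P.BisimLE q r) :
    P.LiftSimulates P.HoweClosure p r := by
  intro b p' hp hproper hfix
  obtain ⟨q', hq, hpq'⟩ := h b p' hp hproper hfix
  obtain ⟨r', hr, hqr'⟩ := isSimulation_bisimLE hP _ _ hqr b q' hq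
  exact ⟨r', hr, .of_rel (.trans_bisimLE (.of_contextClosure hpq') hqr')⟩

theorem liftSimulates_closedMu (hP : P.IsTyftTyxtWithRecursion) {W : Set Var}
    {S S' : W → Term Sg Var W} (h : ∀ (Y : W) (σ : W → ClosedTerm Sg Var),
      P.BisimLE ((S Y).subst σ) ((S' Y).subst σ)) (X : W) :
    P.LiftSimulates P.HoweClosure (closedMu W S X) (closedMu W S' X) := by
  intro b p' _ _ hfix
  have hlift := hfix W _ X rfl
  rw [unfold_rename_inr] at hlift
  obtain ⟨F, hF⟩ := hlift
  let τ (Y : W) : Marking (RelatedPair.left (R := P.HoweClosure)) (closedMu W S Y) :=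
    .ofRel (.mu W S S' h Y)
  let m := F (Marking.subst (S X) τ)
  have hm : P.Step ((S X).subst (closedMu W S')) b (value RelatedPair.right m.val) := by
    simpa only [Marking.value_subst, τ, Marking.value_ofRel] using hF (Marking.subst (S X) τ)
  obtain ⟨q', hq, hbisim⟩ := isSimulation_bisimLE hP.1 _ _ (h X (closedMu W S')) b _ hm
  rw [← unfold_rename_inr] at hq
  exact ⟨q', hq.fix hP.2, .of_rel (.trans_bisimLE (.of_contextClosure m.contextClosure) hbisim)⟩

theorem liftSimulates_value {R : ClosedTerm Sg Var → ClosedTerm Sg Var → Prop} {α : Type z}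
    {l r : α → ClosedTerm Sg Var} (h : ∀ a, R (l a) (r a))
    (hlift : ∀ a, P.LiftSimulates R (l a) (r a)) (m : MarkedTerm Sg Var α PEmpty) :
    P.LiftSimulates R (value l m) (value r m) := by
  by_cases hm : ∃ a, m = marker a
  · obtain ⟨a, rfl⟩ := hm
    simpa only [value_marker] using hlift a
  · rintro b p' - ⟨F, hF⟩ -
    let n : Marking (RelatedPair.left (R := R)) (value l m) :=
      ⟨map (fun a => ⟨l a, r a, h a⟩) m, value_map _ _ m⟩
    have hn : n.IsProper := fun a ha => hm (exists_eq_marker_of_map ha)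
    have hvalue : value RelatedPair.right n.val = value r m := value_map _ _ m
    exact ⟨_, hvalue ▸ hF ⟨n, hn⟩, (F ⟨n, hn⟩).contextClosure⟩

theorem HoweClosure.liftSimulates (hP : P.IsTyftTyxtWithRecursion) {p q : ClosedTerm Sg Var}
    (h : P.HoweClosure p q) : P.LiftSimulates P.HoweClosure p q := by
  induction h with
  | mu W S S' h X => exact liftSimulates_closedMu hP h X
  | context l r h m ih => exact liftSimulates_value h ih m
  | trans_bisimLE _ hqr ih => exact liftSimulates_of_bisimLE hP.1 ih hqr

theorem isSimulation_howeClosure (hP : P.IsTyftTyxtWithRecursion) :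
    P.IsSimulation P.HoweClosure := by
  intro p q hpq b p' hp
  obtain ⟨q', hq, hcontext⟩ := isSimulation_contextClosure hP.2
    (fun _ _ h => HoweClosure.liftSimulates hP h) p q (.of_rel hpq) b p' hp
  exact ⟨q', hq, .of_contextClosure hcontext⟩

theorem HoweClosure.bisimLE (hP : P.IsTyftTyxtWithRecursion) {p q : ClosedTerm Sg Var}
    (h : P.HoweClosure p q) : P.BisimLE p q := by
  refine bisimLE_of_isSimulation hP.1 (R := Relation.Comp P.BisimLE P.HoweClosure) ?_ ?_
    ⟨p, .refl p, h⟩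
  · rintro p q ⟨u, hpu, huq⟩ b p' hp
    obtain ⟨u', hu, hpu'⟩ := isSimulation_bisimLE hP.1 p u hpu b p' hp
    obtain ⟨q', hq, huq'⟩ := isSimulation_howeClosure hP u q huq b u' hu
    exact ⟨q', hq, u', hpu', huq'⟩
  · rintro p q ⟨u, hpu, huq⟩
    obtain ⟨t, hqt, htu⟩ := huq.exists_symm hP
    exact ⟨t, hqt, htu.trans_bisimLE (hpu.symm hP.1)⟩

end HoweClosure

theorem isFullCongruence_bisimLE (hP : P.IsTyftTyxtWithRecursion) :
    IsFullCongruence P.BisimLE where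
  refl := .refl
  trans _ _ _ := .trans
  symm _ _ := .symm hP.1
  op _ _ _ := .op hP
  recursion W S S' h X := (HoweClosure.mu W S S' h X).bisimLE hP

theorem bisimEquiv_eq_bisimLE (hP : P.IsPositive) : P.BisimEquiv = P.BisimLE :=
  funext₂ fun _ _ => propext ⟨And.left, fun h => ⟨h, h.symm hP⟩⟩

end TSS

end SOS

theorem mainTheorem2 {Sg : SOS.Signature.{v}} {Var : Type u} {A : Type w}
    (P : SOS.TSS Sg Var A) (hP : P.IsTyftTyxtWithRecursion) :
    SOS.IsFullCongruence P.BisimLE ∧ SOS.IsFullCongruence P.BisimEquiv := by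
  have hbisim : SOS.IsFullCongruence P.BisimLE := SOS.TSS.isFullCongruence_bisimLE hP
  exact ⟨hbisim, SOS.TSS.bisimEquiv_eq_bisimLE hP.1 ▸ hbisim⟩
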